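/- Let $a>0$ be a real number. The Buckley--Osthus random graph $H_{a,1}^n$ on the vertices $1,\dots,n$ is built step by step, starting from the empty graph $H_{a,1}^0$: at step $t\ge 1$ one adds to $H_{a,1}^{t-1}$ the vertex $t$ and one edge $ti$, where, given $H_{a,1}^{t-1}$, $$\Pr(i=s)=\begin{cases}\dfrac{d_{H_{a,1}^{t-1}}(s)-1+a}{(a+1)t-1}, & 1\le s\le t-1,\\[2mm] \dfrac{a}{(a+1)t-1}, & s=t,\end{cases}$$ and $d_{H}(s)$ is the degree of $s$ in $H$ (a loop counts twice). The second degree $d_2(t)$ of a vertex $t$ is the number of edges that are not incident to $t$ but are incident to some neighbour of $t$. Let $Y_n(k)$ be the number of vertices $t$ of $H_{a,1}^n$ with $d_2(t)\ge k$. Then $\mathbb{E}\,Y_n(k)=\Theta\left(n/k^a\right)$ for $1\le k=O\left(n^{1/(1+a)}\right)$. That is, for every $C$ there are constants $c_1,c_2>0$ and $n_0$, depending only on $a$ and $C$, such that for all integers $n\ge n_0$ and $k$ with $1\le k\le C\,n^{1/(1+a)}$, $$c_1\,\frac{n}{k^a}\;\le\;\mathbb{E}\,Y_n(k)\;\le\;c_2\,\frac{n}{k^a}.$$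 -/

import Mathlib

namespace BuckleyOsthus

/-- The possible outcomes of the process after `n` steps. The vertices are the elements of `Fin n`,
in the order of their appearance (so `t : Fin n` is the vertex number `t + 1`). Every vertex `t`
sends exactly one edge, at the moment of its creation, to some vertex `g t ≤ t`
(`g t = t` is a loop). -/
abbrev Graph (n : ℕ) : Type := (t : Fin n) → Fin (t.val + 1)

/-- The vertex at the other end of the edge that was added together with the vertex `t`. -/
def target {n : ℕ} (g : Graph n) (t : Fin n) : Fin n :=
  ⟨(g t).val, lt_of_lt_of_le (g t).isLt t.isLt⟩

/-- The set of edges. (Edges sent by distinct vertices are distinct, so nothing is lost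
by using a set rather than a multiset.) -/
def edges {n : ℕ} (g : Graph n) : Finset (Sym2 (Fin n)) :=
  Finset.univ.image fun t => s(t, target g t)

/-- The degree of the vertex `s`, a loop being counted twice. -/
def degree {n : ℕ} (g : Graph n) (s : Fin n) : ℕ :=
  ∑ t : Fin n, ((if t = s then 1 else 0) + (if target g t = s then 1 else 0))

/-- The number of edges not incident to `t` that are incident to a neighbour of `t`. -/
def secondDegree {n : ℕ} (g : Graph n) (t : Fin n) : ℕ :=
  ((edges g).filter fun e => t ∉ e ∧ ∃ i ∈ e, s(i, t) ∈ edges g).card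

/-- The number of vertices with second degree at least `k`. -/
def Y {n : ℕ} (g : Graph n) (k : ℕ) : ℕ :=
  (Finset.univ.filter fun t : Fin n => k ≤ secondDegree g t).card

/-- Given the graph `g` on `n` vertices, the probability that the new vertex, number `n + 1`,
sends its edge to the vertex `s`. -/
noncomputable def attachProb (a : ℝ) {n : ℕ} (g : Graph n) (s : Fin (n + 1)) : ℝ :=
  if h : s.val < n then ((degree g ⟨s.val, h⟩ : ℝ) - 1 + a) / ((a + 1) * ((n : ℝ) + 1) - 1)
  else a / ((a + 1) * ((n : ℝ) + 1) - 1)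

theorem one_le_degree {n : ℕ} (g : Graph n) (s : Fin n) : 1 ≤ degree g s := by
  unfold degree
  rw [Finset.sum_add_distrib]
  simp

theorem sum_degree {n : ℕ} (g : Graph n) : ∑ s, degree g s = 2 * n := by
  unfold degree
  rw [Finset.sum_comm]
  simp [Finset.sum_add_distrib]
  ring

theorem denom_pos {a : ℝ} (ha : 0 < a) (n : ℕ) : 0 < (a + 1) * ((n : ℝ) + 1) - 1 := by
  have : (0 : ℝ) ≤ n := n.cast_nonneg
  nlinarith [mul_nonneg ha.le this]

theorem attachProb_nonneg {a : ℝ} (ha : 0 < a) {n : ℕ} (g : Graph n) (s : Fin (n + 1)) :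
    0 ≤ attachProb a g s := by
  have hd := denom_pos ha n
  unfold attachProb
  split_ifs with h
  · have h1 : (1 : ℝ) ≤ degree g ⟨s.val, h⟩ := by exact_mod_cast one_le_degree g _
    exact div_nonneg (by linarith) hd.le
  · exact div_nonneg ha.le hd.le

theorem sum_attachProb {a : ℝ} (ha : 0 < a) {n : ℕ} (g : Graph n) :
    ∑ s, attachProb a g s = 1 := by
  have hd := denom_pos ha n
  have hs : (∑ s, (degree g s : ℝ)) = 2 * n := by exact_mod_cast sum_degree g
  rw [Fin.sum_univ_castSucc]
  simp only [attachProb, Fin.val_castSucc, Fin.is_lt, dite_true, Fin.val_last, lt_irrefl,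
    dite_false, Fin.eta]
  rw [← Finset.sum_div, ← add_div, div_eq_one_iff_eq hd.ne', Finset.sum_add_distrib,
    Finset.sum_sub_distrib, hs]
  simp
  ring

/-- The conditional law of the endpoint of the new edge, given the graph `g` on `n` vertices. -/
noncomputable def attachLaw (a : ℝ) (ha : 0 < a) {n : ℕ} (g : Graph n) : PMF (Fin (n + 1)) :=
  PMF.ofFintype (fun s => ENNReal.ofReal (attachProb a g s)) (by
    rw [← ENNReal.ofReal_sum_of_nonneg fun s _ => attachProb_nonneg ha g s, sum_attachProb ha g,
      ENNReal.ofReal_one])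

/-- The graph `g` with a new vertex and an edge from it to `s`. -/
def addVertex {n : ℕ} (g : Graph n) (s : Fin (n + 1)) : Graph (n + 1) :=
  Fin.snoc (α := fun t : Fin (n + 1) => Fin (t.val + 1)) g s

/-- The law of the random graph `H_{a,1}^n`. -/
noncomputable def law (a : ℝ) (ha : 0 < a) : (n : ℕ) → PMF (Graph n)
  | 0 => PMF.pure fun t => t.elim0
  | n + 1 => (law a ha n).bind fun g => (attachLaw a ha g).map (addVertex g)

/-- The expectation of the number of vertices with second degree at least `k` in `H_{a,1}^n`. -/
noncomputable def expectedY (a : ℝ) (ha : 0 < a) (n k : ℕ) : ℝ :=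
  ∫ g, (Y g k : ℝ) ∂(law a ha n).toMeasure

end BuckleyOsthus

/-! Every vertex sends one edge, to itself or to an older vertex, so the graph is a forest with
loops at the roots. The second degree of `t` is then controlled by the in-degree of its target and
by its number of grandchildren.

Lower bound. A vertex with at least `k + 1` incoming edges has at least `k` children other than
itself, and each of them has second degree at least `k`; hence `Y` is at least `k` times the number
of such vertices (`mul_tailCount_le_Y`). The expected in-degree tails obey a linear recursion in
time whose solution has order `n / k ^ (1 + a)`, as long as `k ^ (1 + a) = O(n)`
(`exists_le_expectedTail`). Only here is the size of `k` restricted.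

Upper bound. If `t` has second degree at least `k`, then its target has in-degree at least `k / 2`
or `t` has at least `k / 2` grandchildren (`Y_le`). Vertices of the first kind are counted by the
edges into vertices of large in-degree, and summing the tails gives `n / k ^ a`
(`expect_sum_indegree_le`). The second kind is handled by Markov's inequality with moments of order
`a`, whose sum over all vertices is `O(n)` in expectation (`exists_expect_grandchildren_le`); a
Lyapunov function mixing children and grandchildren proves this. -/

namespace BuckleyOsthus

/-! ### Expectations as finite sums and conditioning on the last step -/

/-- The expectation of a function of the random graph. -/
noncomputable def expect (a : ℝ) (ha : 0 < a) (n : ℕ) (F : Graph n → ℝ) : ℝ :=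
  ∑ g, (law a ha n g).toReal * F g

theorem expectedY_eq_expect (a : ℝ) (ha : 0 < a) (n k : ℕ) :
    expectedY a ha n k = expect a ha n fun g => (Y g k : ℝ) := by
  simp [expectedY, expect, PMF.integral_eq_sum]

theorem sum_toReal_bind {α β : Type*} [Fintype α] [Fintype β] (p : PMF α) (q : α → PMF β)
    (F : β → ℝ) :
    ∑ b, (p.bind q b).toReal * F b = ∑ x, (p x).toReal * ∑ b, (q x b).toReal * F b := by
  have h : ∀ b, (p.bind q b).toReal = ∑ x, (p x).toReal * (q x b).toReal := fun b => by
    rw [PMF.bind_apply, tsum_fintype, ENNReal.toReal_sum]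
    · simp
    · exact fun x _ => ENNReal.mul_ne_top (p.apply_ne_top x) ((q x).apply_ne_top b)
  simp_rw [h, Finset.sum_mul, Finset.mul_sum]
  rw [Finset.sum_comm]
  simp_rw [mul_assoc]

theorem sum_toReal_map {α β : Type*} [Fintype α] [Fintype β] (p : PMF α) (f : α → β)
    (F : β → ℝ) : ∑ b, (p.map f b).toReal * F b = ∑ x, (p x).toReal * F (f x) := by
  classical
  rw [← PMF.bind_pure_comp, sum_toReal_bind]
  refine Finset.sum_congr rfl fun x _ => ?_
  rw [Finset.sum_eq_single (f x)]
  · simp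
  · intro b _ hb
    simp [hb]
  · simp

theorem expect_succ (a : ℝ) (ha : 0 < a) (n : ℕ) (F : Graph (n + 1) → ℝ) :
    expect a ha (n + 1) F =
      expect a ha n fun g => ∑ s, attachProb a g s * F (addVertex g s) := by
  unfold expect
  rw [law, sum_toReal_bind]
  refine Finset.sum_congr rfl fun g _ => ?_
  rw [sum_toReal_map]
  congr 1
  refine Finset.sum_congr rfl fun s _ => ?_
  simp [attachLaw, ENNReal.toReal_ofReal (attachProb_nonneg ha g s)]

section expect

variable {a : ℝ} {ha : 0 < a} {n : ℕ}

theorem expect_mono {F G : Graph n → ℝ} (h : ∀ g, F g ≤ G g) :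
    expect a ha n F ≤ expect a ha n G :=
  Finset.sum_le_sum fun g _ => mul_le_mul_of_nonneg_left (h g) ENNReal.toReal_nonneg

theorem expect_const (c : ℝ) : expect a ha n (fun _ => c) = c := by
  have h : ∑ g, (law a ha n g).toReal = 1 := by
    rw [← ENNReal.toReal_sum fun g _ => PMF.apply_ne_top _ g,
      ← tsum_fintype (L := .unconditional _), PMF.tsum_coe, ENNReal.toReal_one]
  rw [expect, ← Finset.sum_mul, h, one_mul]

theorem expect_add (F G : Graph n → ℝ) :
    expect a ha n (fun g => F g + G g) = expect a ha n F + expect a ha n G := by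
  simp [expect, mul_add, Finset.sum_add_distrib]

theorem expect_const_mul (c : ℝ) (F : Graph n → ℝ) :
    expect a ha n (fun g => c * F g) = c * expect a ha n F := by
  rw [expect, expect, Finset.mul_sum]
  exact Finset.sum_congr rfl fun g _ => by ring

theorem expect_sum {ι : Type*} (s : Finset ι) (F : ι → Graph n → ℝ) :
    expect a ha n (fun g => ∑ i ∈ s, F i g) = ∑ i ∈ s, expect a ha n (F i) := by
  simp only [expect, Finset.mul_sum]
  exact Finset.sum_comm

theorem expect_nonneg {F : Graph n → ℝ} (h : ∀ g, 0 ≤ F g) : 0 ≤ expect a ha n F :=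
  Finset.sum_nonneg fun g _ => mul_nonneg ENNReal.toReal_nonneg (h g)

end expect

/-! ### Children and grandchildren, and their change in one step -/

/-- The number of edges sent to `p`, a loop being counted once. -/
def indegree {n : ℕ} (g : Graph n) (p : Fin n) : ℕ :=
  (Finset.univ.filter fun t => target g t = p).card

/-- The number of vertices at distance two from `p` that point towards `p`. -/
def grandchildren {n : ℕ} (g : Graph n) (p : Fin n) : ℕ :=
  (Finset.univ.filter fun u => target g u ≠ p ∧ target g (target g u) = p).card

theorem target_le {n : ℕ} (g : Graph n) (t : Fin n) : target g t ≤ t :=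
  Fin.le_def.2 (Nat.lt_succ_iff.1 (g t).isLt)

theorem degree_eq_indegree_add_one {n : ℕ} (g : Graph n) (s : Fin n) :
    degree g s = indegree g s + 1 := by
  unfold degree indegree
  rw [Finset.sum_add_distrib, Finset.card_filter]
  simp [add_comm]

theorem indegree_le {n : ℕ} (g : Graph n) (p : Fin n) : indegree g p ≤ n :=
  (Finset.card_filter_le _ _).trans (by simp)

@[simp] theorem target_addVertex_castSucc {n : ℕ} (g : Graph n) (s : Fin (n + 1)) (t : Fin n) :
    target (addVertex g s) t.castSucc = (target g t).castSucc := by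
  apply Fin.ext
  simp only [target, addVertex, Fin.val_castSucc]
  exact congrArg Fin.val (Fin.snoc_castSucc (α := fun t : Fin (n + 1) => Fin (t.val + 1)) s g t)

@[simp] theorem target_addVertex_last {n : ℕ} (g : Graph n) (s : Fin (n + 1)) :
    target (addVertex g s) (Fin.last n) = s := by
  apply Fin.ext
  simp only [target, addVertex]
  exact congrArg Fin.val (Fin.snoc_last (α := fun t : Fin (n + 1) => Fin (t.val + 1)) s g)

theorem indegree_addVertex_castSucc {n : ℕ} (g : Graph n) (s : Fin (n + 1)) (p : Fin n) :
    indegree (addVertex g s) p.castSucc = indegree g p + if s = p.castSucc then 1 else 0 := by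
  simp [indegree, Finset.card_filter, -Finset.sum_boole, Fin.sum_univ_castSucc]

theorem indegree_addVertex_last {n : ℕ} (g : Graph n) (s : Fin (n + 1)) :
    indegree (addVertex g s) (Fin.last n) = if s = Fin.last n then 1 else 0 := by
  simp [indegree, Finset.card_filter, -Finset.sum_boole, Fin.sum_univ_castSucc,
    Fin.castSucc_ne_last]

theorem grandchildren_addVertex_castSucc {n : ℕ} (g : Graph n) (i p : Fin n) :
    grandchildren (addVertex g i.castSucc) p.castSucc =
      grandchildren g p + if i ≠ p ∧ target g i = p then 1 else 0 := by
  simp [grandchildren, Finset.card_filter, -Finset.sum_boole, Fin.sum_univ_castSucc]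

theorem grandchildren_addVertex_last_castSucc {n : ℕ} (g : Graph n) (p : Fin n) :
    grandchildren (addVertex g (Fin.last n)) p.castSucc = grandchildren g p := by
  simp [grandchildren, Finset.card_filter, -Finset.sum_boole, Fin.sum_univ_castSucc,
    (Fin.castSucc_ne_last p).symm]

theorem grandchildren_addVertex_last {n : ℕ} (g : Graph n) (s : Fin (n + 1)) :
    grandchildren (addVertex g s) (Fin.last n) = 0 := by
  induction s using Fin.lastCases <;>
    simp [grandchildren, Finset.card_filter, -Finset.sum_boole, Fin.sum_univ_castSucc,
    Fin.castSucc_ne_last]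

theorem attachProb_castSucc (a : ℝ) {n : ℕ} (g : Graph n) (p : Fin n) :
    attachProb a g p.castSucc = (indegree g p + a) / ((a + 1) * n + a) := by
  simp only [attachProb, Fin.val_castSucc, Fin.is_lt, dite_true, Fin.eta,
    degree_eq_indegree_add_one]
  push_cast
  congr 1 <;> ring

theorem attachProb_last (a : ℝ) {n : ℕ} (g : Graph n) :
    attachProb a g (Fin.last n) = a / ((a + 1) * n + a) := by
  simp only [attachProb, Fin.val_last, lt_irrefl, dite_false]
  congr 1
  ring

theorem sum_attachProb_castSucc_add_last {a : ℝ} (ha : 0 < a) {n : ℕ} (g : Graph n) :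
    ∑ i : Fin n, (indegree g i + a) / ((a + 1) * n + a) + a / ((a + 1) * n + a) = 1 := by
  have h := sum_attachProb ha g
  rw [Fin.sum_univ_castSucc] at h
  simpa only [attachProb_castSucc, attachProb_last] using h

/-! ### The one-step recursion for in-degree tails -/

/-- The number of vertices with at least `k` incoming edges. -/
def tailCount {n : ℕ} (g : Graph n) (k : ℕ) : ℝ :=
  ∑ p : Fin n, if k ≤ indegree g p then (1 : ℝ) else 0

/-- The count rises by one exactly when the chosen old vertex has in-degree `k`, and there are
`tailCount g k - tailCount g (k + 1)` such vertices. The new vertex itself counts only if it has a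
loop and `k = 0`. -/
theorem sum_attachProb_mul_tailCount {a : ℝ} (ha : 0 < a) {n : ℕ} (g : Graph n) (k : ℕ) :
    ∑ s, attachProb a g s * tailCount (addVertex g s) (k + 1) =
      tailCount g (k + 1) + (k + a) / ((a + 1) * n + a) * (tailCount g k - tailCount g (k + 1)) +
        (if k = 0 then 1 else 0) * (a / ((a + 1) * n + a)) := by
  have hold : ∀ i : Fin n, tailCount (addVertex g i.castSucc) (k + 1) =
      tailCount g (k + 1) + if indegree g i = k then 1 else 0 := fun i => by
    have hp : ∀ p : Fin n, (if k + 1 ≤ indegree g p + (if i = p then 1 else 0)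
        then (1 : ℝ) else 0) = (if k + 1 ≤ indegree g p then 1 else 0) +
          if i = p then (if indegree g i = k then 1 else 0) else 0 := fun p => by
      by_cases hip : i = p
      · subst hip
        rcases lt_trichotomy (indegree g i) k with h | h | h
        · simp [h.ne, show ¬ k ≤ indegree g i by omega, show ¬ k + 1 ≤ indegree g i by omega]
        · simp [h]
        · simp [h.ne', show k ≤ indegree g i by omega, show k + 1 ≤ indegree g i by omega]
      · simp [hip]
    simp only [tailCount, Fin.sum_univ_castSucc, indegree_addVertex_castSucc,
      indegree_addVertex_last, Fin.castSucc_inj, Fin.castSucc_ne_last, if_false]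
    rw [Finset.sum_congr rfl fun p _ => hp p, Finset.sum_add_distrib]
    simp
  have hnew : tailCount (addVertex g (Fin.last n)) (k + 1) =
      tailCount g (k + 1) + if k = 0 then 1 else 0 := by
    simp [tailCount, -Finset.sum_boole, Fin.sum_univ_castSucc, indegree_addVertex_castSucc,
      indegree_addVertex_last, (Fin.castSucc_ne_last _).symm]
  have hdiff : (k + a) * (tailCount g k - tailCount g (k + 1)) =
      ∑ i : Fin n, (indegree g i + a) * if indegree g i = k then (1 : ℝ) else 0 := by
    rw [tailCount, tailCount, ← Finset.sum_sub_distrib, Finset.mul_sum]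
    refine Finset.sum_congr rfl fun i _ => ?_
    rcases lt_trichotomy (indegree g i) k with h | h | h
    · simp [h.ne, show ¬ k ≤ indegree g i by omega, show ¬ k + 1 ≤ indegree g i by omega]
    · simp [h]
    · simp [h.ne', h.le, show k + 1 ≤ indegree g i by omega]
  have h1 := sum_attachProb_castSucc_add_last ha g
  rw [Fin.sum_univ_castSucc]
  simp only [attachProb_castSucc, attachProb_last, hold, hnew, mul_add, Finset.sum_add_distrib]
  rw [← Finset.sum_mul, div_mul_eq_mul_div (k + a : ℝ), hdiff, Finset.sum_div]
  simp only [div_mul_eq_mul_div] at *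
  linear_combination tailCount g (k + 1) * h1


/-! ### The stationary tail and its decay of order `1 + a` -/

/-- The limiting proportion of vertices with at least `k` incoming edges. -/
noncomputable def tailCoeff (a : ℝ) : ℕ → ℝ
  | 0 => 1
  | k + 1 => (k + a) / (k + 1 + 2 * a) * tailCoeff a k

theorem tailCoeff_pos {a : ℝ} (ha : 0 < a) (k : ℕ) : 0 < tailCoeff a k := by
  induction k with
  | zero => simp [tailCoeff]
  | succ k ih => rw [tailCoeff]; positivity

theorem tailCoeff_succ_mul {a : ℝ} (ha : 0 < a) (k : ℕ) :
    (k + 1 + 2 * a) * tailCoeff a (k + 1) = (k + a) * tailCoeff a k := by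
  have : (k + 1 + 2 * a : ℝ) ≠ 0 := by positivity
  rw [tailCoeff]
  field_simp

theorem tailCoeff_antitone {a : ℝ} (ha : 0 < a) : Antitone (tailCoeff a) := by
  refine antitone_nat_of_succ_le fun k => ?_
  have h := tailCoeff_succ_mul ha k
  have hp := tailCoeff_pos ha (k + 1)
  have hk : (0 : ℝ) < k + a := by positivity
  have : (k + a) * tailCoeff a (k + 1) ≤ (k + a) * tailCoeff a k := by nlinarith
  exact le_of_mul_le_mul_left this hk

/-- By Bernoulli's inequality with exponent `1 + a`, the left side is nonincreasing in `k`; the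
right side is its value at `k = 0`. -/
theorem tailCoeff_mul_rpow_le {a : ℝ} (ha : 0 < a) (k : ℕ) :
    tailCoeff a k * (k + 2 * a) ^ (1 + a) ≤ (2 * a) ^ (1 + a) := by
  induction k with
  | zero => simp [tailCoeff]
  | succ k ih =>
    have hk : (0 : ℝ) < k + 1 + 2 * a := by positivity
    have hb := one_add_mul_self_le_rpow_one_add (s := -1 / (k + 1 + 2 * a)) (p := 1 + a)
      (by rw [le_div_iff₀ hk]; linarith [(Nat.cast_nonneg k : (0 : ℝ) ≤ k)]) (by linarith)
    have e1 : 1 + (1 + a) * (-1 / (k + 1 + 2 * a)) = (k + a) / (k + 1 + 2 * a) := by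
      field_simp; ring
    have e2 : 1 + -1 / (k + 1 + 2 * a) = (k + 2 * a) / (k + 1 + 2 * a) := by field_simp; ring
    rw [e1, e2, Real.div_rpow (by positivity) hk.le, le_div_iff₀ (by positivity)] at hb
    refine le_trans ?_ ih
    rw [tailCoeff]
    push_cast
    calc (k + a) / (k + 1 + 2 * a) * tailCoeff a k * (k + 1 + 2 * a) ^ (1 + a)
        = tailCoeff a k * ((k + a) / (k + 1 + 2 * a) * (k + 1 + 2 * a) ^ (1 + a)) := by ring
      _ ≤ _ := mul_le_mul_of_nonneg_left hb (tailCoeff_pos ha k).le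

/-- With the shift `a` in place of `2 * a`, Bernoulli's inequality makes the product nondecreasing
instead. -/
theorem le_tailCoeff_mul_rpow {a : ℝ} (ha : 0 < a) (k : ℕ) :
    a ^ (1 + a) ≤ tailCoeff a k * (k + a) ^ (1 + a) := by
  induction k with
  | zero => simp [tailCoeff]
  | succ k ih =>
    have hk : (0 : ℝ) < k + a := by positivity
    have hk' : (0 : ℝ) < k + 1 + 2 * a := by positivity
    have hb := one_add_mul_self_le_rpow_one_add (s := 1 / (k + a)) (p := 1 + a)
      (by linarith [one_div_pos.2 hk]) (by linarith)
    have e1 : 1 + (1 + a) * (1 / (k + a)) = (k + 1 + 2 * a) / (k + a) := by field_simp; ring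
    have e2 : 1 + 1 / (k + a) = (k + 1 + a) / (k + a) := by field_simp; ring
    rw [e1, e2, Real.div_rpow (by positivity) hk.le, div_le_div_iff₀ hk (by positivity)] at hb
    refine ih.trans ?_
    rw [tailCoeff]
    push_cast
    calc tailCoeff a k * (k + a) ^ (1 + a)
        = tailCoeff a k * (((k + 1 + 2 * a) * (k + a) ^ (1 + a)) / (k + 1 + 2 * a)) := by
          field_simp
      _ ≤ tailCoeff a k * (((k + 1 + a) ^ (1 + a) * (k + a)) / (k + 1 + 2 * a)) := by
          refine mul_le_mul_of_nonneg_left ?_ (tailCoeff_pos ha k).le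
          gcongr
      _ = _ := by ring

theorem tailCoeff_le {a : ℝ} (ha : 0 < a) {k : ℕ} (hk : 1 ≤ k) :
    tailCoeff a k ≤ (2 * a) ^ (1 + a) / k ^ (1 + a) := by
  have hk0 : (0 : ℝ) < k := by exact_mod_cast hk
  rw [le_div_iff₀ (by positivity)]
  refine le_trans ?_ (tailCoeff_mul_rpow_le ha k)
  have := (tailCoeff_pos ha k).le
  gcongr
  linarith

theorem le_tailCoeff {a : ℝ} (ha : 0 < a) {k : ℕ} (hk : 1 ≤ k) :
    (a / (1 + a)) ^ (1 + a) / k ^ (1 + a) ≤ tailCoeff a k := by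
  have hk0 : (1 : ℝ) ≤ k := by exact_mod_cast hk
  have h := le_tailCoeff_mul_rpow ha k
  have h2 : ((k : ℝ) + a) ^ (1 + a) ≤ ((1 + a) * k) ^ (1 + a) := by
    gcongr
    nlinarith
  rw [Real.mul_rpow (by positivity) (by positivity)] at h2
  rw [Real.div_rpow ha.le (by positivity), div_div, div_le_iff₀ (by positivity)]
  exact h.trans (mul_le_mul_of_nonneg_left h2 (tailCoeff_pos ha k).le)

/-- The recursion reads `a * f (j + 1) = (j + a) * f j - (j + 1 + a) * f (j + 1)`, so the sum
telescopes. -/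
theorem sum_tailCoeff_le {a : ℝ} (ha : 0 < a) (k m : ℕ) :
    a * ∑ j ∈ Finset.Ico k m, tailCoeff a (j + 1) ≤ (k + a) * tailCoeff a k := by
  rcases le_total m k with h | h
  · rw [Finset.Ico_eq_empty_of_le h]
    have := tailCoeff_pos ha k
    simp only [Finset.sum_empty, mul_zero]
    positivity
  · have : a * ∑ j ∈ Finset.Ico k m, tailCoeff a (j + 1) =
        (k + a) * tailCoeff a k - (m + a) * tailCoeff a m := by
      induction m, h using Nat.le_induction with
      | base => simp
      | succ m h ih =>
        rw [Finset.sum_Ico_succ_top h, mul_add, ih]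
        push_cast
        linear_combination tailCoeff_succ_mul ha m
    have hm := tailCoeff_pos ha m
    rw [this]
    have : 0 ≤ (m + a) * tailCoeff a m := by positivity
    linarith

/-! ### Two-sided bounds for expected in-degree tails -/

/-- The expected number of vertices with at least `k` incoming edges. -/
noncomputable def expectedTail (a : ℝ) (ha : 0 < a) (n k : ℕ) : ℝ :=
  expect a ha n fun g => tailCount g k

theorem tailCount_nonneg {n : ℕ} (g : Graph n) (k : ℕ) : 0 ≤ tailCount g k :=
  Finset.sum_nonneg fun _ _ => by split_ifs <;> simp

theorem expectedTail_nonneg {a : ℝ} (ha : 0 < a) (n k : ℕ) : 0 ≤ expectedTail a ha n k :=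
  expect_nonneg fun g => tailCount_nonneg g k

theorem expectedTail_zero_right {a : ℝ} (ha : 0 < a) (n : ℕ) : expectedTail a ha n 0 = n := by
  simp [expectedTail, tailCount, expect_const]

theorem expectedTail_eq_zero {a : ℝ} (ha : 0 < a) {n k : ℕ} (h : n < k) :
    expectedTail a ha n k = 0 := by
  have : ∀ g : Graph n, tailCount g k = 0 := fun g =>
    Finset.sum_eq_zero fun p _ => if_neg (by have := indegree_le g p; omega)
  simp [expectedTail, this, expect_const]

theorem expectedTail_succ {a : ℝ} (ha : 0 < a) (n k : ℕ) :
    expectedTail a ha (n + 1) (k + 1) = expectedTail a ha n (k + 1) +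
      (k + a) / ((a + 1) * n + a) * (expectedTail a ha n k - expectedTail a ha n (k + 1)) +
        (if k = 0 then 1 else 0) * (a / ((a + 1) * n + a)) := by
  have h : (fun g : Graph n => tailCount g (k + 1) + (k + a) / ((a + 1) * n + a) *
      (tailCount g k - tailCount g (k + 1)) + (if k = 0 then 1 else 0) * (a / ((a + 1) * n + a))) =
      fun g : Graph n => tailCount g (k + 1) + ((k + a) / ((a + 1) * n + a) * tailCount g k +
        (-((k + a) / ((a + 1) * n + a)) * tailCount g (k + 1) +
          (if k = 0 then 1 else 0) * (a / ((a + 1) * n + a)))) := by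
    funext g
    ring
  unfold expectedTail
  rw [expect_succ]
  simp only [sum_attachProb_mul_tailCount ha]
  rw [h]
  simp only [expect_add, expect_const_mul, expect_const]
  ring

theorem attach_ratio_le_one {a : ℝ} (ha : 0 < a) {n k : ℕ} (h : k ≤ n) :
    (k + a) / ((a + 1) * n + a) ≤ 1 := by
  rw [div_le_one (by positivity)]
  have : (k : ℝ) ≤ n := by exact_mod_cast h
  nlinarith [(Nat.cast_nonneg n : (0 : ℝ) ≤ n)]

/-- This stationarity identity dictates the definition of `tailCoeff`: it makes `(n + a / (a + 1)) *
tailCoeff a k` an exact solution of the recursion without its loop term. -/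
theorem attach_ratio_mul_tailCoeff {a : ℝ} (ha : 0 < a) (n k : ℕ) :
    (k + a) / ((a + 1) * n + a) * (tailCoeff a k - tailCoeff a (k + 1)) =
      (a + 1) / ((a + 1) * n + a) * tailCoeff a (k + 1) := by
  have : ((a + 1) * n + a : ℝ) ≠ 0 := by positivity
  field_simp
  linear_combination -tailCoeff_succ_mul ha k

/-- The right side is a supersolution of the recursion. Induction preserves the inequality because
the recursion has nonnegative coefficients when `k ≤ n`; beyond that range the tail vanishes. -/
theorem expectedTail_le {a : ℝ} (ha : 0 < a) (n k : ℕ) :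
    expectedTail a ha n k ≤ (1 + 2 * a) / a * n * tailCoeff a k := by
  induction n generalizing k with
  | zero =>
    rcases k with _ | k
    · simp [expectedTail_zero_right]
    · simp [expectedTail_eq_zero ha (Nat.succ_pos k)]
  | succ n ih =>
    have hc : 1 ≤ (1 + 2 * a) / a := by rw [le_div_iff₀ ha]; linarith
    rcases k with _ | k
    · rw [expectedTail_zero_right, tailCoeff, mul_one]
      exact le_mul_of_one_le_left (by positivity) hc
    rcases lt_or_ge n k with h | h
    · rw [expectedTail_eq_zero ha (by omega)]
      have := tailCoeff_pos ha (k + 1)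
      positivity
    have hx1 := attach_ratio_le_one ha h
    have hx0 : 0 ≤ (k + a) / ((a + 1) * n + a) := by positivity
    have hr := attach_ratio_mul_tailCoeff ha n k
    have hd : (0 : ℝ) < (a + 1) * n + a := by positivity
    rw [expectedTail_succ]
    have h1 := mul_le_mul_of_nonneg_left (ih (k + 1)) (sub_nonneg.2 hx1)
    have h2 := mul_le_mul_of_nonneg_left (ih k) hx0
    -- The factor `(1 + 2 * a) / a` is `1 / tailCoeff a 1`, the least one that absorbs the loop
    -- term; equality holds at `k = 0`.
    have hf : (if k = 0 then 1 else 0) ≤ (1 + 2 * a) / a * tailCoeff a (k + 1) := by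
      have := tailCoeff_pos ha (k + 1)
      split_ifs with h0
      · subst h0
        have : (1 + 2 * a) ≠ 0 := by positivity
        apply le_of_eq
        simp only [tailCoeff]
        push_cast
        field_simp
        ring
      · positivity
    have h3 := mul_le_mul_of_nonneg_right hf (show 0 ≤ a / ((a + 1) * n + a) by positivity)
    have e : (1 + 2 * a) / a * ((n + 1 : ℕ) : ℝ) * tailCoeff a (k + 1) =
        (1 + 2 * a) / a * n * tailCoeff a (k + 1) +
        (1 + 2 * a) / a * n * ((a + 1) / ((a + 1) * n + a) * tailCoeff a (k + 1)) +
        (1 + 2 * a) / a * tailCoeff a (k + 1) * (a / ((a + 1) * n + a)) := by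
      push_cast
      field_simp
      ring
    rw [e, ← hr]
    nlinarith

theorem expectedTail_pos {a : ℝ} (ha : 0 < a) {n k : ℕ} (h : k < n) :
    0 < expectedTail a ha n k := by
  induction n generalizing k with
  | zero => omega
  | succ n ih =>
    rcases k with _ | k
    · rw [expectedTail_zero_right]
      positivity
    have hx1 := attach_ratio_le_one ha (show k ≤ n by omega)
    have hx0 : 0 < (k + a) / ((a + 1) * n + a) := by positivity
    have h1 := mul_nonneg (sub_nonneg.2 hx1) (expectedTail_nonneg ha n (k + 1))
    have h2 := mul_pos hx0 (ih (show k < n by omega))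
    have h3 : 0 ≤ (if k = 0 then 1 else 0) * (a / ((a + 1) * n + a)) :=
      mul_nonneg (by split_ifs <;> simp) (by positivity)
    rw [expectedTail_succ]
    nlinarith

/-- Propagation in time of a lower bound on the expected numbers of vertices of large degree. -/
theorem le_expectedTail_of_le {a : ℝ} (ha : 0 < a) {N : ℕ} {c B : ℝ} (hc : 0 ≤ c)
    (hB0 : 0 ≤ B)
    (hB : ∀ n k : ℕ, N ≤ n → n ≤ k → (n + a / (a + 1)) * tailCoeff a k ≤ B)
    (hc1 : c * ((1 + a / (a + 1)) * tailCoeff a 0) ≤ 1)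
    (hN : ∀ k, k < N → c * ((N + a / (a + 1)) * tailCoeff a k - B) ≤ expectedTail a ha N k)
    {n : ℕ} (hn : N ≤ n) (k : ℕ) :
    c * ((n + a / (a + 1)) * tailCoeff a k - B) ≤ expectedTail a ha n k := by
  -- Constants also solve the recursion without its loop term. Subtracting `B` makes the claim
  -- trivial for `n ≤ k`, which covers the range where a coefficient could be negative.
  have hneg : ∀ n k : ℕ, N ≤ n → n ≤ k →
      c * ((n + a / (a + 1)) * tailCoeff a k - B) ≤ expectedTail a ha n k := fun n k h h' =>
    (mul_nonpos_of_nonneg_of_nonpos hc (by linarith [hB n k h h'])).trans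
      (expectedTail_nonneg ha n k)
  induction n, hn using Nat.le_induction generalizing k with
  | base =>
    rcases lt_or_ge k N with h | h
    · exact hN k h
    · exact hneg N k le_rfl h
  | succ n hn ih =>
    rcases k with _ | k
    · rw [expectedTail_zero_right]
      rw [tailCoeff, mul_one] at *
      have hq : 0 ≤ a / (a + 1) := by positivity
      push_cast
      have hcB := mul_nonneg hc hB0
      have hn0 : (0 : ℝ) ≤ n := n.cast_nonneg
      have : 0 ≤ c * (n * (a / (a + 1))) := by positivity
      nlinarith [mul_le_mul_of_nonneg_left hc1 (show (0 : ℝ) ≤ n + 1 by positivity)]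
    rcases lt_or_ge n k with h | h
    · exact hneg _ _ (by omega) (by omega)
    have hx1 := attach_ratio_le_one ha h
    have hx0 : 0 ≤ (k + a) / ((a + 1) * n + a) := by positivity
    have hr := attach_ratio_mul_tailCoeff ha n k
    have h1 := mul_le_mul_of_nonneg_left (ih (k + 1)) (sub_nonneg.2 hx1)
    have h2 := mul_le_mul_of_nonneg_left (ih k) hx0
    have h3 : 0 ≤ (if k = 0 then 1 else 0) * (a / ((a + 1) * n + a)) :=
      mul_nonneg (by split_ifs <;> simp) (by positivity)
    have hd : (a + 1) * n + a ≠ 0 := by positivity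
    have e : c * ((((n + 1 : ℕ) : ℝ) + a / (a + 1)) * tailCoeff a (k + 1) - B) =
        c * ((n + a / (a + 1)) * tailCoeff a (k + 1) - B) + c * (n + a / (a + 1)) *
          ((a + 1) / ((a + 1) * n + a) * tailCoeff a (k + 1)) := by
      push_cast
      field_simp
      ring
    rw [expectedTail_succ, e, ← hr]
    nlinarith


theorem tailCoeff_le_one {a : ℝ} (ha : 0 < a) (k : ℕ) : tailCoeff a k ≤ 1 :=
  tailCoeff_antitone ha (Nat.zero_le k)

/-- The lower bound on the expected number of vertices of large degree, up to the order of the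
maximal degree. -/
theorem exists_le_expectedTail {a : ℝ} (ha : 0 < a) {K : ℝ} (hK : 0 < K) :
    ∃ c : ℝ, 0 < c ∧ ∃ N : ℕ, ∀ n k : ℕ, N ≤ n → 1 ≤ k → (k : ℝ) ^ (1 + a) ≤ K * n →
      c * (n / (k : ℝ) ^ (1 + a)) ≤ expectedTail a ha n k := by
  set q := a / (a + 1) with hq
  have hq0 : 0 < q := by positivity
  have hq1 : q ≤ 1 := by rw [hq, div_le_one (by positivity)]; linarith
  set L := (a / (1 + a)) ^ (1 + a) with hL
  have hL0 : 0 < L := by positivity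
  set U := (2 * a) ^ (1 + a) with hU
  have hU0 : 0 < U := by positivity
  have hlim : Filter.Tendsto (fun n : ℕ => 2 * U * (n : ℝ) ^ (-a)) Filter.atTop (nhds 0) := by
    simpa using ((tendsto_rpow_neg_atTop ha).comp tendsto_natCast_atTop_atTop).const_mul (2 * U)
  -- The starting time `N` is so late that `B` is at most `L / (2 * K)`, which is at most half of
  -- the main term `L * n / k ^ (1 + a)` when `k ^ (1 + a) ≤ K * n`.
  obtain ⟨N, hN, hN1⟩ := ((hlim.eventually_le_const (show 0 < L / (2 * K) by positivity)).and
    (Filter.eventually_ge_atTop 1)).exists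
  have hN0 : (0 : ℝ) < N := by exact_mod_cast hN1
  set B := 2 * U * (N : ℝ) ^ (-a) with hB
  have hB0 : 0 ≤ B := by positivity
  obtain ⟨δ, hδ0, hδ⟩ : ∃ δ : ℝ, 0 < δ ∧ ∀ k < N, δ ≤ expectedTail a ha N k := by
    obtain ⟨k₀, hk₀, hmin⟩ := Finset.exists_min_image (Finset.range N) (expectedTail a ha N)
      ⟨0, Finset.mem_range.2 hN1⟩
    exact ⟨_, expectedTail_pos ha (Finset.mem_range.1 hk₀),
      fun k hk => hmin k (Finset.mem_range.2 hk)⟩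
  -- The first bound on `c` gives the comparison at time `N`, the second the one at the boundary `k
  -- = 0`.
  set c := min (δ / (N + q)) (1 / (1 + q)) with hc
  have hc0 : 0 < c := by positivity
  refine ⟨c * (L / 2), by positivity, N, fun n k hn hk hkn => ?_⟩
  have key := le_expectedTail_of_le ha (N := N) (c := c) (B := B) hc0.le hB0 ?_ ?_ ?_ hn k
  · refine le_trans ?_ key
    rw [mul_assoc]
    refine mul_le_mul_of_nonneg_left ?_ hc0.le
    have hk0 : (0 : ℝ) < k := by exact_mod_cast hk
    have hkp : 0 < (k : ℝ) ^ (1 + a) := by positivity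
    have hf := le_tailCoeff ha hk
    have h1 : n * (L / (k : ℝ) ^ (1 + a)) ≤ (n + q) * tailCoeff a k :=
      mul_le_mul (by linarith) hf (by positivity) (by positivity)
    have h2 : L / (2 * K) ≤ L / 2 * (n / (k : ℝ) ^ (1 + a)) := by
      rw [← mul_div_assoc, div_le_div_iff₀ (by positivity) hkp]
      nlinarith
    have h3 : n * (L / (k : ℝ) ^ (1 + a)) = 2 * (L / 2 * (n / (k : ℝ) ^ (1 + a))) := by ring
    linarith
  · intro n k hn hk
    have hn1 : (1 : ℝ) ≤ n := by exact_mod_cast hN1.trans hn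
    have hn0 : (0 : ℝ) < n := by linarith
    have h1 : tailCoeff a k ≤ U / n ^ (1 + a) :=
      (tailCoeff_antitone ha hk).trans (tailCoeff_le ha (hN1.trans hn))
    calc (n + q) * tailCoeff a k ≤ (2 * n) * (U / n ^ (1 + a)) :=
          mul_le_mul (by linarith) h1 (tailCoeff_pos ha k).le (by positivity)
      _ = 2 * U * (n : ℝ) ^ (-a) := by
          rw [Real.rpow_add hn0, Real.rpow_one, Real.rpow_neg hn0.le]
          field_simp
      _ ≤ B := mul_le_mul_of_nonneg_left (Real.rpow_le_rpow_of_nonpos hN0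
          (by exact_mod_cast hn) (by linarith)) (by positivity)
  · calc c * ((1 + q) * tailCoeff a 0) ≤ 1 / (1 + q) * ((1 + q) * 1) := by
          rw [tailCoeff]
          exact mul_le_mul_of_nonneg_right (min_le_right _ _) (by positivity)
      _ = 1 := by field_simp
  · intro k hk
    refine le_trans ?_ (hδ k hk)
    have h1 : (N + q) * tailCoeff a k ≤ (N + q) * 1 :=
      mul_le_mul_of_nonneg_left (tailCoeff_le_one ha k) (by positivity)
    calc c * ((N + q) * tailCoeff a k - B) ≤ c * (N + q) :=
          mul_le_mul_of_nonneg_left (by linarith) hc0.le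
      _ ≤ δ / (N + q) * (N + q) := mul_le_mul_of_nonneg_right (min_le_left _ _) (by positivity)
      _ = δ := by field_simp

/-! ### Edges into vertices of large in-degree, by summing tails -/

theorem ite_le_eq_add_sum {n D : ℕ} (k : ℕ) (h : D ≤ n) :
    (if k ≤ D then (D : ℝ) else 0) = k * (if k ≤ D then 1 else 0) +
      ∑ j ∈ Finset.Ico k n, if j + 1 ≤ D then (1 : ℝ) else 0 := by
  have hs : (Finset.Ico k n).filter (fun j => j + 1 ≤ D) = Finset.Ico k D := by
    ext j
    simp only [Finset.mem_filter, Finset.mem_Ico]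
    omega
  rw [Finset.sum_boole, hs, Nat.card_Ico]
  split_ifs with hk
  · rw [Nat.cast_sub hk]
    ring
  · simp [Nat.sub_eq_zero_of_le (not_le.1 hk).le]

/-- The expected number of edges sent to vertices with at least `k` incoming edges. -/
theorem expect_sum_indegree_le {a : ℝ} (ha : 0 < a) :
    ∃ c : ℝ, 0 < c ∧ ∀ n k : ℕ, 1 ≤ k →
      expect a ha n (fun g => ∑ p, if k ≤ indegree g p then (indegree g p : ℝ) else 0) ≤
        c * (n / (k : ℝ) ^ a) := by
  refine ⟨(1 + 2 * a) / a * ((1 + (1 + a) / a) * (2 * a) ^ (1 + a)), by positivity,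
    fun n k hk => ?_⟩
  have hk1 : (1 : ℝ) ≤ k := by exact_mod_cast hk
  have hk0 : (0 : ℝ) < k := by linarith
  have hdec : ∀ g : Graph n, (∑ p, if k ≤ indegree g p then (indegree g p : ℝ) else 0) =
      k * tailCount g k + ∑ j ∈ Finset.Ico k n, tailCount g (j + 1) := fun g => by
    rw [Finset.sum_congr rfl fun p _ => ite_le_eq_add_sum k (indegree_le g p),
      Finset.sum_add_distrib, ← Finset.mul_sum, Finset.sum_comm]
    rfl
  have hf := (tailCoeff_pos ha k).le
  have hsum : ∑ j ∈ Finset.Ico k n, tailCoeff a (j + 1) ≤ (1 + a) / a * (k * tailCoeff a k) := by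
    rw [div_mul_eq_mul_div, le_div_iff₀ ha, mul_comm]
    refine (sum_tailCoeff_le ha k n).trans ?_
    rw [← mul_assoc]
    exact mul_le_mul_of_nonneg_right (by nlinarith) hf
  simp only [hdec, expect_add, expect_const_mul, expect_sum]
  calc k * expectedTail a ha n k + ∑ j ∈ Finset.Ico k n, expectedTail a ha n (j + 1)
      ≤ k * ((1 + 2 * a) / a * n * tailCoeff a k) +
        ∑ j ∈ Finset.Ico k n, (1 + 2 * a) / a * n * tailCoeff a (j + 1) := by
        gcongr
        · exact expectedTail_le ha n k
        · exact expectedTail_le ha n _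
    _ = (1 + 2 * a) / a * n *
        (k * tailCoeff a k + ∑ j ∈ Finset.Ico k n, tailCoeff a (j + 1)) := by
        rw [← Finset.mul_sum]; ring
    _ ≤ (1 + 2 * a) / a * n * ((1 + (1 + a) / a) * (k * ((2 * a) ^ (1 + a) / k ^ (1 + a)))) := by
        refine mul_le_mul_of_nonneg_left ?_ (by positivity)
        calc _ ≤ (1 + (1 + a) / a) * (k * tailCoeff a k) := by linarith
          _ ≤ _ := by
            have := tailCoeff_le ha hk
            gcongr
    _ = _ := by
        rw [Real.rpow_add hk0 1 a, Real.rpow_one]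
        field_simp


/-! ### Moments of order `a` of the numbers of grandchildren -/

/-- The derivative of `(1 + u) ^ a` at `0` is `a < b`. This replaces Bernoulli's inequality, which
has the wrong direction for `a > 1`. -/
theorem exists_one_add_rpow_le {a b : ℝ} (hab : a < b) :
    ∃ δ : ℝ, 0 < δ ∧ ∀ u : ℝ, 0 ≤ u → u ≤ δ → (1 + u) ^ a ≤ 1 + b * u := by
  have hd : HasDerivAt (fun u : ℝ => (1 + u) ^ a) a 0 := by
    simpa using ((hasDerivAt_id (0 : ℝ)).const_add 1).rpow_const (p := a) (Or.inl (by simp))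
  have ho := (hasDerivAt_iff_isLittleO_nhds_zero.1 hd).def (sub_pos.2 hab)
  obtain ⟨ε, hε, h⟩ := Metric.eventually_nhds_iff.1 ho
  refine ⟨ε / 2, by positivity, fun u hu hu' => ?_⟩
  have := h (y := u) (by rw [Real.dist_eq, sub_zero, abs_of_nonneg hu]; linarith)
  simp only [zero_add, add_zero, Real.one_rpow, smul_eq_mul, Real.norm_eq_abs,
    abs_of_nonneg hu] at this
  nlinarith [le_abs_self ((1 + u) ^ a - 1 - u * a)]

theorem sum_children_indegree {n : ℕ} (g : Graph n) (p : Fin n) :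
    ∑ i, (if i ≠ p ∧ target g i = p then indegree g i else 0) = grandchildren g p := by
  have h : ∀ i, (if i ≠ p ∧ target g i = p then indegree g i else 0) =
      ∑ u, if target g u = i then (if i ≠ p ∧ target g i = p then 1 else 0) else 0 := fun i => by
    split_ifs <;> simp [indegree]
  rw [Finset.sum_congr rfl fun i _ => h i, Finset.sum_comm, grandchildren, Finset.card_filter]
  exact Finset.sum_congr rfl fun u _ => by rw [Finset.sum_ite_eq]; simp

/-- Up to the normalisation, the left side is the chance that `p` gains a grandchild. Equality fails
only if `p` has a loop, since `p` then counts in its own in-degree. -/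
theorem sum_children_indegree_add_le {a : ℝ} (ha : 0 < a) {n : ℕ} (g : Graph n) (p : Fin n) :
    ∑ i, (indegree g i + a) * (if i ≠ p ∧ target g i = p then (1 : ℝ) else 0) ≤
      grandchildren g p + a * indegree g p := by
  have h1 : (grandchildren g p : ℝ) =
      ∑ i, (if i ≠ p ∧ target g i = p then (indegree g i : ℝ) else 0) := by
    rw [← sum_children_indegree]
    push_cast
    rfl
  have h2 : (indegree g p : ℝ) = ∑ i, if target g i = p then (1 : ℝ) else 0 := by
    rw [indegree, Finset.card_filter]
    push_cast
    rfl
  rw [h1, h2, Finset.mul_sum, ← Finset.sum_add_distrib]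
  refine Finset.sum_le_sum fun i _ => ?_
  by_cases h' : i = p
  · have : (0 : ℝ) ≤ if target g i = p then 1 else 0 := by split_ifs <;> simp
    simpa [h'] using mul_nonneg ha.le this
  · by_cases h : target g i = p <;> simp [h, h']

/-- A linear combination of the numbers of children and grandchildren of a vertex. -/
def potential (K M : ℝ) {n : ℕ} (g : Graph n) (p : Fin n) : ℝ :=
  grandchildren g p + K * indegree g p + M

theorem potential_addVertex_castSucc (K M : ℝ) {n : ℕ} (g : Graph n) (i p : Fin n) :
    potential K M (addVertex g i.castSucc) p.castSucc = potential K M g p +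
      (K * (if i = p then 1 else 0) + if i ≠ p ∧ target g i = p then 1 else 0) := by
  simp only [potential, grandchildren_addVertex_castSucc, indegree_addVertex_castSucc,
    Fin.castSucc_inj]
  push_cast
  ring

/-- The growth in one step of the sum of the powers of the potentials. -/
theorem sum_attachProb_mul_potential_le {a b K M : ℝ} (ha : 0 < a) (hb : 0 ≤ b) (hK : 1 ≤ K)
    (hM : 0 < M) (haM : a * K ≤ M)
    (hp : ∀ u : ℝ, 0 ≤ u → u ≤ K / M → (1 + u) ^ a ≤ 1 + b * u) {n : ℕ} (g : Graph n) :
    ∑ s, attachProb a g s * ∑ p, potential K M (addVertex g s) p ^ a ≤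
      (∑ p, potential K M g p ^ a) * (1 + b * (1 + a / K) / ((a + 1) * n + a)) + (K + M) ^ a := by
  have hK0 : 0 < K := by linarith
  have hV : ∀ p, M ≤ potential K M g p := fun p => by
    unfold potential
    have : 0 ≤ K * indegree g p := by positivity
    linarith [(Nat.cast_nonneg (grandchildren g p) : (0 : ℝ) ≤ _)]
  have hV0 : ∀ p, 0 < potential K M g p := fun p => hM.trans_le (hV p)
  -- Increments are at most `K` and potentials at least `M`, so the relative increment stays in the
  -- range where `hp` linearises the power.
  have hinc : ∀ p, ∀ x : ℝ, 0 ≤ x → x ≤ K → (potential K M g p + x) ^ a ≤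
      potential K M g p ^ a + b * (potential K M g p ^ a / potential K M g p) * x := by
    intro p x hx hxK
    have hv := hV0 p
    have h1 := hp (x / potential K M g p) (by positivity) (div_le_div₀ hK0.le hxK hM (hV p))
    have e : potential K M g p + x = potential K M g p * (1 + x / potential K M g p) := by
      field_simp
    rw [e, Real.mul_rpow hv.le (by positivity)]
    calc _ ≤ potential K M g p ^ a * (1 + b * (x / potential K M g p)) :=
          mul_le_mul_of_nonneg_left h1 (by positivity)
      _ = _ := by ring
  set d : ℝ := (a + 1) * n + a with hd
  have hd0 : 0 < d := by positivity
  have hold : ∀ i : Fin n, ∑ p, potential K M (addVertex g i.castSucc) p ^ a ≤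
      ∑ p, potential K M g p ^ a + (K + M) ^ a +
        ∑ p, b * (potential K M g p ^ a / potential K M g p) *
          (K * (if i = p then 1 else 0) + if i ≠ p ∧ target g i = p then 1 else 0) := by
    intro i
    rw [Fin.sum_univ_castSucc]
    have hl : potential K M (addVertex g i.castSucc) (Fin.last n) ^ a ≤ (K + M) ^ a := by
      simp only [potential, grandchildren_addVertex_last, indegree_addVertex_last,
        Fin.castSucc_ne_last, if_false, Nat.cast_zero, mul_zero, zero_add]
      gcongr
      linarith
    have hs : ∑ p : Fin n, potential K M (addVertex g i.castSucc) p.castSucc ^ a ≤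
        ∑ p, (potential K M g p ^ a + b * (potential K M g p ^ a / potential K M g p) *
          (K * (if i = p then 1 else 0) + if i ≠ p ∧ target g i = p then 1 else 0)) := by
      refine Finset.sum_le_sum fun p _ => ?_
      rw [potential_addVertex_castSucc]
      apply hinc
      · positivity
      · by_cases h : i = p
        · simp [h]
        · simp only [h, if_false, mul_zero, zero_add]
          split_ifs <;> linarith
    rw [Finset.sum_add_distrib] at hs
    linarith
  have hnew : ∑ p, potential K M (addVertex g (Fin.last n)) p ^ a =
      ∑ p, potential K M g p ^ a + (K + M) ^ a := by
    simp [Fin.sum_univ_castSucc, potential, grandchildren_addVertex_last_castSucc,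
      indegree_addVertex_castSucc, grandchildren_addVertex_last, indegree_addVertex_last,
      (Fin.castSucc_ne_last _).symm]
  have hw : ∀ i, 0 ≤ (indegree g i + a) / d := fun i => by positivity
  -- The unnormalised drift is at most `K * (d + a) + G + a * d`, with `d` children and `G`
  -- grandchildren. The weight `K` reduces the feedback `a * d` to a fraction `a / K` of the
  -- potential, and `a * K ≤ M` absorbs the constant.
  have hgen : ∀ p, ∑ i, (indegree g i + a) *
      (K * (if i = p then 1 else 0) + if i ≠ p ∧ target g i = p then 1 else 0) ≤
        (1 + a / K) * potential K M g p := by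
    intro p
    have h1 := sum_children_indegree_add_le ha g p
    simp only [mul_add, Finset.sum_add_distrib, mul_ite, mul_one, mul_zero,
      Finset.sum_ite_eq', Finset.mem_univ, if_true] at h1 ⊢
    have h2 : (1 + a / K) * potential K M g p =
        potential K M g p + (a / K * grandchildren g p + a * indegree g p + a / K * M) := by
      unfold potential; field_simp
    have h3 : 0 ≤ a / K * M := by positivity
    have h4 : 0 ≤ a / K * grandchildren g p := by positivity
    rw [h2]
    unfold potential
    linarith
  have h1 := sum_attachProb_castSucc_add_last ha g
  rw [Fin.sum_univ_castSucc]
  simp only [attachProb_castSucc, attachProb_last, hnew]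
  rw [← hd] at h1 ⊢
  set T := ∑ p, potential K M g p ^ a with hT
  calc _ ≤ ∑ i : Fin n, (indegree g i + a) / d * (T + (K + M) ^ a +
        ∑ p, b * (potential K M g p ^ a / potential K M g p) *
          (K * (if i = p then 1 else 0) + if i ≠ p ∧ target g i = p then 1 else 0)) +
          a / d * (T + (K + M) ^ a) :=
        add_le_add_left (Finset.sum_le_sum fun i _ => mul_le_mul_of_nonneg_left (hold i) (hw i)) _
    _ = T + (K + M) ^ a + ∑ p, b * (potential K M g p ^ a / potential K M g p) / d *
          ∑ i, (indegree g i + a) *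
            (K * (if i = p then 1 else 0) + if i ≠ p ∧ target g i = p then 1 else 0) := by
        simp only [mul_add ((_ : ℝ) / d) (T + _), Finset.sum_add_distrib, ← Finset.sum_mul,
          Finset.mul_sum]
        rw [Finset.sum_comm (s := Finset.univ (α := Fin n))]
        have : ∀ x y z : ℝ, x = y → (∑ i : Fin n, (indegree g i + a) / d) * z + x + a / d * z =
            z + y := fun x y z h => by linear_combination z * h1 + h
        apply this
        exact Finset.sum_congr rfl fun p _ => Finset.sum_congr rfl fun i _ => by ring
    _ ≤ T + (K + M) ^ a + ∑ p, b * (potential K M g p ^ a / potential K M g p) / d *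
          ((1 + a / K) * potential K M g p) := by
        gcongr with p
        · have := hV0 p
          positivity
        · exact hgen p
    _ = T + (K + M) ^ a + T * (b * (1 + a / K) / d) := by
        rw [hT, Finset.sum_mul]
        congr 1
        refine Finset.sum_congr rfl fun p _ => ?_
        have := (hV0 p).ne'
        field_simp
    _ = _ := by ring

/-- The numbers of grandchildren have bounded moments of order `a`. -/
theorem exists_expect_grandchildren_le {a : ℝ} (ha : 0 < a) :
    ∃ R : ℝ, 0 < R ∧ ∀ n,
      expect a ha n (fun g => ∑ p, (grandchildren g p : ℝ) ^ a) ≤ R * n := by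
  set b := a + 1 / (4 * (1 + a)) with hb
  have hab : a < b := by rw [hb]; linarith [show 0 < 1 / (4 * (1 + a)) by positivity]
  obtain ⟨δ, hδ, hu⟩ := exists_one_add_rpow_le hab
  set K := 2 * a ^ 2 + 1 with hK
  have hK1 : 1 ≤ K := by nlinarith [sq_nonneg a]
  have hK0 : 0 < K := by linarith
  set M := max (a * K) (K / δ) with hM
  have hM0 : 0 < M := lt_max_of_lt_left (by positivity)
  have hKM : K / M ≤ δ := by
    rw [div_le_iff₀ hM0, mul_comm, ← div_le_iff₀ hδ]
    exact le_max_right _ _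
  -- The growth rate must stay below `a + 1` for the sum to be linear in `n`. The choices of `K` and
  -- `b` cost at most `1 / 2` and `1 / 4` above `a`.
  set lam := b * (1 + a / K) with hlam
  have hlam1 : lam ≤ a + 3 / 4 := by
    have h1 : a * (a / K) ≤ 1 / 2 := by
      rw [← mul_div_assoc, div_le_iff₀ hK0, hK]
      nlinarith
    have h2 : 1 / (4 * (1 + a)) * (1 + a / K) ≤ 1 / (4 * (1 + a)) * (1 + a) := by
      gcongr
      exact div_le_self ha.le hK1
    have h3 : 1 / (4 * (1 + a)) * (1 + a) = 1 / 4 := by field_simp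
    have : lam = a + a * (a / K) + 1 / (4 * (1 + a)) * (1 + a / K) := by
      rw [hlam, hb]; ring
    linarith
  have hlam0 : 0 ≤ lam := by have := ha.trans hab; positivity
  -- This solves `R * (a + 3 / 4) / (a + 1) + (K + M) ^ a = R`: growth of the old potentials plus
  -- the new vertex.
  set R := 4 * (a + 1) * (K + M) ^ a with hR
  have hR0 : 0 < R := by positivity
  refine ⟨R, hR0, fun n => ?_⟩
  have hpot : expect a ha n (fun g => ∑ p, potential K M g p ^ a) ≤ R * n := by
    induction n with
    | zero => simp [expect_const]
    | succ n ih =>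
      rw [expect_succ]
      refine (expect_mono fun g => sum_attachProb_mul_potential_le ha (ha.trans hab).le hK1 hM0
        (le_max_left _ _) (fun u h0 h1 => hu u h0 (h1.trans hKM)) g).trans ?_
      rw [expect_add, expect_const]
      simp only [mul_comm (Finset.sum _ _)]
      rw [expect_const_mul]
      have hd : (0 : ℝ) < (a + 1) * n + a := by positivity
      have h1 : (1 + lam / ((a + 1) * n + a)) *
          expect a ha n (fun g => ∑ p, potential K M g p ^ a) ≤
          (1 + lam / ((a + 1) * n + a)) * (R * n) :=
        mul_le_mul_of_nonneg_left ih (by positivity)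
      have h2 : lam / ((a + 1) * n + a) * (R * n) ≤ R * ((a + 3 / 4) / (a + 1)) := by
        rw [div_mul_eq_mul_div, div_le_iff₀ hd]
        have e : R * ((a + 3 / 4) / (a + 1)) * ((a + 1) * n + a) =
            (a + 3 / 4) * (R * n) + R * ((a + 3 / 4) / (a + 1)) * a := by field_simp
        rw [e]
        have : 0 ≤ R * ((a + 3 / 4) / (a + 1)) * a := by positivity
        have := mul_le_mul_of_nonneg_right hlam1 (show 0 ≤ R * n by positivity)
        linarith
      have h3 : R * ((a + 3 / 4) / (a + 1)) + (K + M) ^ a = R := by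
        rw [hR]; field_simp; ring
      push_cast
      linarith
  refine (expect_mono fun g => Finset.sum_le_sum fun p _ => ?_).trans hpot
  have : 0 ≤ K * indegree g p := by positivity
  unfold potential
  gcongr
  linarith


/-! ### Second degree in terms of children and grandchildren -/

theorem edge_injective {n : ℕ} (g : Graph n) : Function.Injective fun t => s(t, target g t) := by
  intro u v h
  rcases Sym2.eq_iff.1 h with h | h
  · exact h.1
  · exact le_antisymm (h.1.trans_le (target_le g v)) (h.2.symm.trans_le (target_le g u))

theorem mem_edges {n : ℕ} {g : Graph n} {i t : Fin n} :
    s(i, t) ∈ edges g ↔ target g i = t ∨ target g t = i := by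
  simp only [edges, Finset.mem_image, Finset.mem_univ, true_and, Sym2.eq_iff]
  constructor
  · rintro ⟨x, ⟨rfl, rfl⟩ | ⟨rfl, rfl⟩⟩ <;> simp
  · rintro (h | h)
    · exact ⟨i, Or.inl ⟨rfl, h⟩⟩
    · exact ⟨t, Or.inr ⟨rfl, h⟩⟩

/-- A counted edge is sent by a grandchild of `t`, by a sibling of `t`, or by the target of `t`. The
last edge makes up for `t` itself being excluded from the siblings. -/
theorem secondDegree_le {n : ℕ} (g : Graph n) (t : Fin n) :
    secondDegree g t ≤ grandchildren g t + indegree g (target g t) := by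
  classical
  set A := Finset.univ.filter fun u => target g u ≠ t ∧ target g (target g u) = t with hA
  set D := Finset.univ.filter fun u => target g u = target g t with hD
  have hsub : (edges g).filter (fun e => t ∉ e ∧ ∃ i ∈ e, s(i, t) ∈ edges g) ⊆
      (A ∪ insert (target g t) (D.erase t)).image fun u => s(u, target g u) := by
    intro e he
    obtain ⟨he, ht, i, hi, hit⟩ := Finset.mem_filter.1 he
    obtain ⟨u, -, rfl⟩ := Finset.mem_image.1 he
    refine Finset.mem_image.2 ⟨u, ?_, rfl⟩
    rw [Sym2.mem_iff, not_or] at ht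
    rw [mem_edges] at hit
    simp only [Finset.mem_union, Finset.mem_insert, Finset.mem_erase, hA, hD, Finset.mem_filter,
      Finset.mem_univ, true_and]
    rcases Sym2.mem_iff.1 hi with rfl | rfl <;> rcases hit with h | h
    · exact absurd h.symm ht.2
    · exact Or.inr (Or.inl h.symm)
    · exact Or.inl ⟨Ne.symm ht.2, h⟩
    · exact Or.inr (Or.inr ⟨Ne.symm ht.1, h.symm⟩)
  have htD : t ∈ D := by simp [hD]
  calc secondDegree g t ≤ (A ∪ insert (target g t) (D.erase t)).card :=
        (Finset.card_le_card hsub).trans Finset.card_image_le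
    _ ≤ A.card + ((D.erase t).card + 1) :=
        (Finset.card_union_le _ _).trans (by gcongr; exact Finset.card_insert_le _ _)
    _ = _ := by rw [Finset.card_erase_add_one htD]; rfl

/-- The edge of every sibling of `t` is counted. A loop at `t` must be excluded, since these edges
would then be incident to `t`. -/
theorem indegree_target_le_secondDegree {n : ℕ} (g : Graph n) {t : Fin n} (h : target g t ≠ t) :
    indegree g (target g t) ≤ secondDegree g t + 1 := by
  classical
  set D := Finset.univ.filter fun u => target g u = target g t with hD
  have htD : t ∈ D := by simp [hD]
  have hsub : (D.erase t).image (fun u => s(u, target g u)) ⊆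
      (edges g).filter fun e => t ∉ e ∧ ∃ i ∈ e, s(i, t) ∈ edges g := by
    intro e he
    obtain ⟨u, hu, rfl⟩ := Finset.mem_image.1 he
    obtain ⟨hut, hu⟩ := Finset.mem_erase.1 hu
    have hu : target g u = target g t := by simpa [hD] using hu
    refine Finset.mem_filter.2 ⟨Finset.mem_image_of_mem _ (Finset.mem_univ u), ?_,
      target g u, by simp, mem_edges.2 (Or.inr hu.symm)⟩
    rw [Sym2.mem_iff, hu, not_or]
    exact ⟨Ne.symm hut, h.symm⟩
  have := Finset.card_le_card hsub
  rw [Finset.card_image_of_injective _ (edge_injective g)] at this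
  calc indegree g (target g t) = (D.erase t).card + 1 := by
        rw [Finset.card_erase_add_one htD]; rfl
    _ ≤ _ := Nat.add_le_add_right this 1

theorem mul_tailCount_le_Y {n : ℕ} (g : Graph n) (k : ℕ) : k * tailCount g (k + 1) ≤ Y g k := by
  classical
  have hsub : (Finset.univ.filter fun p => k + 1 ≤ indegree g p).biUnion
      (fun p => (Finset.univ.filter fun t => target g t = p).erase p) ⊆
      Finset.univ.filter fun t => k ≤ secondDegree g t := by
    intro t ht
    simp only [Finset.mem_biUnion, Finset.mem_filter, Finset.mem_univ, true_and,
      Finset.mem_erase] at ht ⊢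
    obtain ⟨p, hp, htp, rfl⟩ := ht
    have := indegree_target_le_secondDegree g (Ne.symm htp)
    omega
  have hcard := Finset.card_le_card hsub
  rw [Finset.card_biUnion] at hcard
  · have h : (Finset.univ.filter fun p => k + 1 ≤ indegree g p).card * k ≤ Y g k := by
      refine le_trans ?_ hcard
      rw [← smul_eq_mul]
      refine Finset.card_nsmul_le_sum _ _ _ fun p hp => ?_
      have hp : k + 1 ≤ indegree g p := (Finset.mem_filter.1 hp).2
      have := Finset.pred_card_le_card_erase (s := Finset.univ.filter fun t => target g t = p)
        (a := p)
      unfold indegree at hp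
      omega
    rw [tailCount, Finset.sum_boole, mul_comm]
    exact_mod_cast h
  · intro p _ q _ hpq
    refine Finset.disjoint_left.2 fun t hp hq => hpq ?_
    rw [← (Finset.mem_filter.1 (Finset.mem_of_mem_erase hp)).2,
      ← (Finset.mem_filter.1 (Finset.mem_of_mem_erase hq)).2]

theorem Y_le {a : ℝ} (ha : 0 < a) {n : ℕ} (g : Graph n) {k : ℕ} (hk : 1 ≤ k) :
    (Y g k : ℝ) ≤ (2 / k) ^ a * ∑ p, (grandchildren g p : ℝ) ^ a +
      ∑ p, if (k + 1) / 2 ≤ indegree g p then (indegree g p : ℝ) else 0 := by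
  have hk0 : (0 : ℝ) < k := by exact_mod_cast hk
  have hfib : (∑ p, if (k + 1) / 2 ≤ indegree g p then (indegree g p : ℝ) else 0) =
      ∑ t, if (k + 1) / 2 ≤ indegree g (target g t) then (1 : ℝ) else 0 := by
    have h : ∀ p, (if (k + 1) / 2 ≤ indegree g p then (indegree g p : ℝ) else 0) =
        ∑ t, if target g t = p then (if (k + 1) / 2 ≤ indegree g p then (1 : ℝ) else 0) else 0 :=
      fun p => by
        split_ifs with hp
        · rw [Finset.sum_boole]; rfl
        · simp
    rw [Finset.sum_congr rfl fun p _ => h p, Finset.sum_comm]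
    exact Finset.sum_congr rfl fun t _ => by rw [Finset.sum_ite_eq]; simp
  rw [hfib, Finset.mul_sum, ← Finset.sum_add_distrib, Y, ← Finset.sum_boole]
  refine Finset.sum_le_sum fun t _ => ?_
  have hG : 0 ≤ (2 / k : ℝ) ^ a * (grandchildren g t : ℝ) ^ a := by positivity
  split_ifs with h1 h2 h2
  · linarith
  · have hd := secondDegree_le g t
    -- The threshold `(k + 1) / 2` is `k / 2` rounded up, so an in-degree below it leaves at least
    -- half of `k` to the grandchildren.
    have hkG : k ≤ 2 * grandchildren g t := by omega
    have hkG : (k : ℝ) ≤ 2 * grandchildren g t := by exact_mod_cast hkG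
    rw [add_zero, ← Real.mul_rpow (by positivity) (by positivity)]
    apply Real.one_le_rpow _ ha.le
    rw [div_mul_eq_mul_div, le_div_iff₀ hk0]
    linarith
  · linarith
  · linarith

end BuckleyOsthus

/-! ### Assembly of the two bounds -/

theorem corollary1 (a : ℝ) (ha : 0 < a) (C : ℝ) :
    ∃ c₁ c₂ : ℝ, 0 < c₁ ∧ 0 < c₂ ∧ ∃ n₀ : ℕ, ∀ n : ℕ, n₀ ≤ n → ∀ k : ℕ, 1 ≤ k →
      (k : ℝ) ≤ C * (n : ℝ) ^ (1 / (1 + a)) →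
      c₁ * ((n : ℝ) / (k : ℝ) ^ a) ≤ BuckleyOsthus.expectedY a ha n k ∧
        BuckleyOsthus.expectedY a ha n k ≤ c₂ * ((n : ℝ) / (k : ℝ) ^ a) := by
  open BuckleyOsthus in
  -- The factor `2` pays for passing from `k` to `k + 1 ≤ 2 * k`; the maximum gives positivity for
  -- every real `C`.
  set C' := 2 * max C 1 with hC'
  have hC0 : 0 < C' := by have := le_max_right C 1; linarith
  obtain ⟨c, hc, N, hlow⟩ := exists_le_expectedTail ha (K := C' ^ (1 + a)) (by positivity)
  obtain ⟨R, hR, hG⟩ := exists_expect_grandchildren_le ha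
  obtain ⟨c', hc', hD⟩ := expect_sum_indegree_le ha
  refine ⟨c / 2 ^ (1 + a), 2 ^ a * R + 2 ^ a * c', by positivity, by positivity, N,
    fun n hn k hk hkn => ?_⟩
  have hk1 : (1 : ℝ) ≤ k := by exact_mod_cast hk
  have hk0 : (0 : ℝ) < k := by linarith
  have hk2 : (((k + 1 : ℕ) : ℝ)) ≤ 2 * k := by push_cast; linarith
  rw [expectedY_eq_expect]
  constructor
  · have hk' : (((k + 1 : ℕ) : ℝ)) ≤ C' * (n : ℝ) ^ (1 / (1 + a)) := by
      have : C * (n : ℝ) ^ (1 / (1 + a)) ≤ max C 1 * (n : ℝ) ^ (1 / (1 + a)) := by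
        gcongr
        exact le_max_left _ _
      calc _ ≤ 2 * (k : ℝ) := hk2
        _ ≤ _ := by rw [hC', mul_assoc]; linarith
    have hpow : (((k + 1 : ℕ) : ℝ)) ^ (1 + a) ≤ C' ^ (1 + a) * n := by
      refine (Real.rpow_le_rpow (by positivity) hk' (by positivity)).trans_eq ?_
      rw [Real.mul_rpow hC0.le (by positivity), ← Real.rpow_mul (by positivity),
        one_div_mul_cancel (by positivity), Real.rpow_one]
    have hE := expect_mono (ha := ha) fun g : Graph n => mul_tailCount_le_Y g k
    rw [expect_const_mul] at hE
    refine le_trans ?_ hE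
    have h2 : (((k + 1 : ℕ) : ℝ)) ^ (1 + a) ≤ 2 ^ (1 + a) * (k * (k : ℝ) ^ a) := by
      refine (Real.rpow_le_rpow (by positivity) hk2 (by positivity)).trans_eq ?_
      rw [Real.mul_rpow (by positivity) hk0.le, Real.rpow_add hk0 1 a, Real.rpow_one]
    calc c / 2 ^ (1 + a) * (n / (k : ℝ) ^ a)
        = k * (c * (n / (2 ^ (1 + a) * (k * (k : ℝ) ^ a)))) := by field_simp
      _ ≤ k * (c * (n / (((k + 1 : ℕ) : ℝ)) ^ (1 + a))) := by gcongr
      _ ≤ _ := mul_le_mul_of_nonneg_left (hlow n (k + 1) hn (by omega) hpow) hk0.le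
  · refine (expect_mono fun g => Y_le ha g hk).trans ?_
    rw [expect_add, expect_const_mul]
    have hhalf : (k : ℝ) / 2 ≤ (((k + 1) / 2 : ℕ) : ℝ) := by
      rw [div_le_iff₀ two_pos]
      have : k ≤ (k + 1) / 2 * 2 := by omega
      exact_mod_cast this
    calc _ ≤ (2 / k : ℝ) ^ a * (R * n) + c' * (n / (((k + 1) / 2 : ℕ) : ℝ) ^ a) :=
          add_le_add (mul_le_mul_of_nonneg_left (hG n) (by positivity)) (hD n _ (by omega))
      _ ≤ (2 / k : ℝ) ^ a * (R * n) + c' * (n / ((k : ℝ) / 2) ^ a) := by gcongr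
      _ = _ := by
          rw [Real.div_rpow (by positivity) hk0.le, Real.div_rpow hk0.le (by positivity)]
          field_simp
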